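/- **Model.** Let $n\ge 1$, $\mathcal N=\{1,\dots,n\}$. A source has a state $Q(t)$ evolving as an irreducible continuous-time Markov chain on $\{1,\dots,M\}$ with generator $(q_{ij})$ and stationary distribution $\pi$; every change of state creates a new version of the information. Each node $i$ stores a packet consisting of a version and its content $S_i(t)\in\{1,\dots,M\}$, the source state of that version; its version age $X_i(t)\in\{0,1,2,\dots\}$ is the number of versions by which it lags behind the source. The network is the continuous-time Markov chain with the following transitions: - when the source jumps (from $i$ to $j\ne i$ at rate $q_{ij}$), all version ages increase by $1$; - at rate $\lambda_s/n$ for each node $j$, the source sends its packet to $j$, so that $X_j$ becomes $0$ and $S_j$ becomes $Q$; - at rate $\lambda/(n-1)$ for each ordered pair of nodes $i\ne j$, node $i$ sends its packet to $j$, and $j$ replaces its own packet by it if and only if $X_i<X_j$. For a set $A\subseteq\mathcal N$ of $k\ge 1$ nodes let $X_A=\min_{j\in A}X_j$ and $C_A=\frac1k\,\#\{j\in A: S_j=Q\}$, and put $$g_k^{(m)}=\lim_{t\to\infty}\mathbb P\bigl(Q(t)=m,\ X_A(t)=0\bigr),\qquad c_k^{(m)}=\lim_{t\to\infty}\mathbb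 E\bigl[C_A(t)\,\mathbf 1_{\{Q(t)=m\}}\bigr],\qquad G_k=\sum_{m=1}^M c_k^{(m)}g_k^{(m)} .$$ **Statement.** Fix $n$, the generator $(q_{ij})$ and $\lambda\ge 0$. For every $\lambda_s>0$, $k\in\{1,\dots,n\}$ and $m\in\{1,\dots,M\}$, the limits $g_k^{(m)}$ and $c_k^{(m)}$ exist and depend neither on the choice of the $k$-node set $A$ nor on the initial distribution of the network. Moreover, for all $k\in\{1,\dots,n\}$ and $m\in\{1,\dots,M\}$, $$\lim_{\lambda_s\to\infty}g_k^{(m)}=\pi_m,\qquad \lim_{\lambda_s\to\infty}G_k=\lim_{\lambda_s\to\infty}\sum_{m=1}^M c_k^{(m)}\pi_m=\sum_{m=1}^M\pi_m^2 .$$ -/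

import Mathlib

open Filter Topology MeasureTheory
open scoped BoundedContinuousFunction

namespace Gossip

/-- `Q` is the generator matrix of a continuous-time Markov chain on `{1, …, M}`. -/
structure IsGenerator {M : ℕ} (Q : Matrix (Fin M) (Fin M) ℝ) : Prop where
  off_diag_nonneg : ∀ i j, i ≠ j → 0 ≤ Q i j
  row_sum : ∀ i, ∑ j, Q i j = 0

/-- Every state can be reached from every state through transitions of positive rate. -/
def IsIrreducibleGenerator {M : ℕ} (Q : Matrix (Fin M) (Fin M) ℝ) : Prop :=
  ∀ i j, Relation.ReflTransGen (fun a b => a ≠ b ∧ 0 < Q a b) i j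

/-- `p` is a stationary distribution of the chain with generator `Q`. -/
def IsStationary {M : ℕ} (Q : Matrix (Fin M) (Fin M) ℝ) (p : Fin M → ℝ) : Prop :=
  p ∈ stdSimplex ℝ (Fin M) ∧ Matrix.vecMul p Q = 0

/-- A state of the network: the source state `Q`, the version ages `X_i = V_0 - V_i` of the nodes
and the contents `S_i` of their packets. A packet is a version of the source together with the
source state of that version, so packets of the same version (in particular of the current one)
have the same content. -/
@[ext]
structure State (n M : ℕ) where
  src : Fin M
  age : Fin n → ℕ
  content : Fin n → Fin M
  content_of_age_eq_zero : ∀ i, age i = 0 → content i = src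
  content_of_age_eq : ∀ i j, age i = age j → content i = content j

namespace State

variable {n M : ℕ}

instance : TopologicalSpace (State n M) := ⊥

instance : DiscreteTopology (State n M) := ⟨rfl⟩

instance : MeasurableSpace (State n M) := ⊤

/-- The source moves to state `r`: a new version is generated and all version ages grow by one. -/
def jump (r : Fin M) (z : State n M) : State n M where
  src := r
  age := fun i => z.age i + 1
  content := z.content
  content_of_age_eq_zero := fun _ h => absurd h (Nat.succ_ne_zero _)
  content_of_age_eq := fun i j h => z.content_of_age_eq i j (Nat.succ_injective h)

/-- The source sends its current version and state to node `j`. -/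
def push (j : Fin n) (z : State n M) : State n M where
  src := z.src
  age := Function.update z.age j 0
  content := Function.update z.content j z.src
  content_of_age_eq_zero := by
    intro i h
    by_cases hi : i = j
    · subst hi; simp
    · simp only [Function.update_of_ne hi] at h ⊢
      exact z.content_of_age_eq_zero i h
  content_of_age_eq := by
    intro a b h
    by_cases ha : a = j <;> by_cases hb : b = j
    · rw [ha, hb]
    · subst ha
      simp only [Function.update_self, Function.update_of_ne hb] at h ⊢
      exact (z.content_of_age_eq_zero b h.symm).symm
    · subst hb
      simp only [Function.update_self, Function.update_of_ne ha] at h ⊢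
      exact z.content_of_age_eq_zero a h
    · simp only [Function.update_of_ne ha, Function.update_of_ne hb] at h ⊢
      exact z.content_of_age_eq a b h

/-- Node `j` stores the packet of node `i`. -/
def copy (i j : Fin n) (z : State n M) : State n M where
  src := z.src
  age := Function.update z.age j (z.age i)
  content := Function.update z.content j (z.content i)
  content_of_age_eq_zero := by
    intro a h
    by_cases ha : a = j
    · subst ha
      simp only [Function.update_self] at h ⊢
      exact z.content_of_age_eq_zero i h
    · simp only [Function.update_of_ne ha] at h ⊢
      exact z.content_of_age_eq_zero a h
  content_of_age_eq := by
    intro a b h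
    by_cases ha : a = j <;> by_cases hb : b = j
    · rw [ha, hb]
    · subst ha
      simp only [Function.update_self, Function.update_of_ne hb] at h ⊢
      exact z.content_of_age_eq i b h
    · subst hb
      simp only [Function.update_self, Function.update_of_ne ha] at h ⊢
      exact z.content_of_age_eq a i h
    · simp only [Function.update_of_ne ha, Function.update_of_ne hb] at h ⊢
      exact z.content_of_age_eq a b h

/-- Node `i` sends its packet to node `j`, which keeps it if and only if it is fresher than its
own packet. -/
def gossip (i j : Fin n) (z : State n M) : State n M :=
  if z.age i < z.age j then z.copy i j else z

/-- The version age `X_A` of a nonempty set `A` of nodes: the least version age in `A`. -/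
def setAge (z : State n M) (A : Finset (Fin n)) (hA : A.Nonempty) : ℕ :=
  A.inf' hA z.age

/-- The average accuracy `C_A` of a set `A` of nodes: the fraction of the nodes of `A` whose
content is the current state of the source. -/
noncomputable def accuracy (z : State n M) (A : Finset (Fin n)) : ℝ :=
  (∑ l ∈ A, if z.content l = z.src then (1 : ℝ) else 0) / A.card

theorem abs_accuracy_le (z : State n M) (A : Finset (Fin n)) : |z.accuracy A| ≤ 1 := by
  have h0 : 0 ≤ ∑ l ∈ A, if z.content l = z.src then (1 : ℝ) else 0 :=
    Finset.sum_nonneg fun l _ => by split_ifs <;> norm_num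
  have h1 : (∑ l ∈ A, if z.content l = z.src then (1 : ℝ) else 0) ≤ A.card := by
    calc _ ≤ ∑ _l ∈ A, (1 : ℝ) := Finset.sum_le_sum fun l _ => by split_ifs <;> norm_num
      _ = A.card := by simp
  rw [accuracy, abs_of_nonneg (div_nonneg h0 (Nat.cast_nonneg _))]
  exact div_le_one_of_le₀ h1 (Nat.cast_nonneg _)

end State

variable {n M : ℕ}

/-- The test function `1{Q = m, X_A = 0}`. -/
noncomputable def freshObs (A : Finset (Fin n)) (hA : A.Nonempty) (m : Fin M) :
    State n M →ᵇ ℝ :=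
  BoundedContinuousFunction.ofNormedAddCommGroupDiscrete
    (fun z => if z.src = m ∧ z.setAge A hA = 0 then 1 else 0) 1
    (fun z => by split_ifs <;> simp)

/-- The test function `C_A · 1{Q = m}`. -/
noncomputable def accuracyObs (A : Finset (Fin n)) (m : Fin M) : State n M →ᵇ ℝ :=
  BoundedContinuousFunction.ofNormedAddCommGroupDiscrete
    (fun z => if z.src = m then z.accuracy A else 0) 1
    (fun z => by
      split_ifs
      · exact z.abs_accuracy_le A
      · simp)

/-- The rate, as a function of the network state, of the transition of the source to `r`. -/
noncomputable def jumpRate (n : ℕ) (Q : Matrix (Fin M) (Fin M) ℝ) (r : Fin M) :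
    State n M →ᵇ ℝ :=
  BoundedContinuousFunction.ofNormedAddCommGroupDiscrete
    (fun z => if z.src = r then 0 else Q z.src r) (∑ i, |Q i r|)
    (fun z => by
      split_ifs
      · simpa using Finset.sum_nonneg fun i _ => abs_nonneg (Q i r)
      · exact Finset.single_le_sum (f := fun i => |Q i r|) (fun i _ => abs_nonneg _)
          (Finset.mem_univ z.src))

/-- Composition `ψ ↦ ψ ∘ φ` with a reset map `φ`. -/
noncomputable def compReset (φ : State n M → State n M) :
    (State n M →ᵇ ℝ) →L[ℝ] (State n M →ᵇ ℝ) :=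
  BoundedContinuousFunction.compContinuousCLM ℝ ℝ ⟨φ, continuous_of_discreteTopology⟩

@[simp]
theorem compReset_apply (φ : State n M → State n M) (ψ : State n M →ᵇ ℝ) (z : State n M) :
    compReset φ ψ z = ψ (φ z) := rfl

@[simp]
theorem jumpRate_apply (Q : Matrix (Fin M) (Fin M) ℝ) (r : Fin M) (z : State n M) :
    jumpRate n Q r z = if z.src = r then 0 else Q z.src r := rfl

/-- The generator of the network process on bounded functions of the state: the source moves
according to `Q`, sends its packet to each node at rate `ls / n`, and each node sends its packet
to each other node at rate `lam / (n - 1)`. -/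
noncomputable def generator (n : ℕ) (Q : Matrix (Fin M) (Fin M) ℝ) (lam ls : ℝ) :
    (State n M →ᵇ ℝ) →L[ℝ] (State n M →ᵇ ℝ) :=
  (∑ r : Fin M, (ContinuousLinearMap.mul ℝ (State n M →ᵇ ℝ) (jumpRate n Q r)).comp
      (compReset (State.jump r) - ContinuousLinearMap.id ℝ _))
  + (∑ j : Fin n, (ls / n) • (compReset (State.push j) - ContinuousLinearMap.id ℝ _))
  + ∑ i : Fin n, ∑ j ∈ Finset.univ.erase i,
      (lam / ((n : ℝ) - 1)) • (compReset (State.gossip i j) - ContinuousLinearMap.id ℝ _)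

/-- The generator in explicit form. -/
theorem generator_apply (Q : Matrix (Fin M) (Fin M) ℝ) (lam ls : ℝ) (ψ : State n M →ᵇ ℝ)
    (z : State n M) :
    generator n Q lam ls ψ z =
      (∑ r, (if z.src = r then 0 else Q z.src r) * (ψ (z.jump r) - ψ z))
      + (∑ j, ls / n * (ψ (z.push j) - ψ z))
      + ∑ i, ∑ j ∈ Finset.univ.erase i, lam / ((n : ℝ) - 1) * (ψ (z.gossip i j) - ψ z) := by
  simp only [generator, add_apply, sum_apply,
    ContinuousLinearMap.comp_apply, ContinuousLinearMap.mul_apply', sub_apply,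
    smul_apply, ContinuousLinearMap.id_apply,
    BoundedContinuousFunction.coe_add, BoundedContinuousFunction.coe_sum, Pi.add_apply,
    Finset.sum_apply, BoundedContinuousFunction.coe_mul, Pi.mul_apply,
    BoundedContinuousFunction.coe_sub, Pi.sub_apply, BoundedContinuousFunction.coe_smul,
    compReset_apply, jumpRate_apply, smul_eq_mul]

/-- The uniformly continuous semigroup `exp (t L)` with bounded generator `L`. -/
noncomputable def semigroup {E : Type*} [NormedAddCommGroup E] [NormedSpace ℝ E]
    (L : E →L[ℝ] E) (t : ℝ) : E →L[ℝ] E :=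
  NormedSpace.exp (t • L)

/-- The Markov semigroup of the network process; its value `transition n Q lam ls t ψ z` is the
expectation of `ψ` at time `t` for the process that starts in the state `z`. -/
noncomputable def transition (n : ℕ) (Q : Matrix (Fin M) (Fin M) ℝ) (lam ls t : ℝ) :
    (State n M →ᵇ ℝ) →L[ℝ] (State n M →ᵇ ℝ) :=
  semigroup (generator n Q lam ls) t

/-- The expectation of `ψ` at time `t` for the network process with initial law `μ`. -/
noncomputable def expectation (Q : Matrix (Fin M) (Fin M) ℝ) (lam ls : ℝ)
    (μ : Measure (State n M)) (t : ℝ) (ψ : State n M →ᵇ ℝ) : ℝ :=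
  ∫ z, transition n Q lam ls t ψ z ∂μ

/-- `v` is the long-run value `lim_{t → ∞} P(Q(t) = m, X_A(t) = 0)` for every set `A` of `k` nodes
and every initial law of the network. -/
def IsFreshnessLimit (n : ℕ) (Q : Matrix (Fin M) (Fin M) ℝ) (lam ls : ℝ) (k : ℕ) (m : Fin M)
    (v : ℝ) : Prop :=
  ∀ (A : Finset (Fin n)) (hA : A.Nonempty), A.card = k →
    ∀ μ : Measure (State n M), IsProbabilityMeasure μ →
      Tendsto (fun t => expectation Q lam ls μ t (freshObs A hA m)) atTop (𝓝 v)

/-- `v` is the long-run value `lim_{t → ∞} E[C_A(t) 1{Q(t) = m}]` for every set `A` of `k` nodes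
and every initial law of the network. -/
def IsAccuracyLimit (n : ℕ) (Q : Matrix (Fin M) (Fin M) ℝ) (lam ls : ℝ) (k : ℕ) (m : Fin M)
    (v : ℝ) : Prop :=
  ∀ A : Finset (Fin n), A.card = k →
    ∀ μ : Measure (State n M), IsProbabilityMeasure μ →
      Tendsto (fun t => expectation Q lam ls μ t (accuracyObs A m)) atTop (𝓝 v)

end Gossip

/-! The generator L is bounded, so the semigroup is an exponential series. Adding a large multiple
of the identity makes L positive (uniformization), and a lower bound on one iterate then becomes a
lower bound on the semigroup. Pushing once to every node erases all memory except the source state,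
and irreducibility connects the resulting states `State.fresh`; this gives Doeblin's condition
(`exists_doeblin`). Hence the semigroup converges uniformly to an invariant mean ν with ν(L f) = 0
(`IsMarkovGenerator.exists_invariant_mean`). Since the dynamics commute with relabelling the nodes,
the values of ν on the two observables depend on A only through its cardinality.

For the asymptotics, ν(L f) = 0 is tested on f = 1{X_j > 0}. Only source jumps create staleness, at
rate at most C = ∑ |Q i r|, and pushes to j remove it at rate ls/n; so ν f ≤ C n / ls
(`generator_staleObs_le`). A node with age 0 forces X_A = 0 and has accurate content, so both limits
lie within C n / ls of ν(1{Q = m}) = p m (`exists_limits`). The sums over m then converge termwise.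
-/

namespace Gossip

/-! ### Exponentials of bounded operators -/

section Semigroup

theorem semigroup_add {E : Type*} [NormedAddCommGroup E] [NormedSpace ℝ E] [CompleteSpace E]
    (L : E →L[ℝ] E) (s t : ℝ) : semigroup L (s + t) = semigroup L s * semigroup L t := by
  let _ : NormedAlgebra ℚ (E →L[ℝ] E) := NormedAlgebra.restrictScalars ℚ ℝ _
  rw [semigroup, add_smul, NormedSpace.exp_add_of_commute]
  · rfl
  · exact ((Commute.refl L).smul_left s).smul_right t

theorem commute_semigroup {E : Type*} [NormedAddCommGroup E] [NormedSpace ℝ E]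
    {A L : E →L[ℝ] E} (h : Commute A L) (t : ℝ) : Commute A (semigroup L t) :=
  (h.smul_right t).exp_right

theorem hasSum_semigroup_apply {E F : Type*} [NormedAddCommGroup E] [NormedSpace ℝ E] [CompleteSpace E]
    [NormedAddCommGroup F] [NormedSpace ℝ F] (φ : E →L[ℝ] F) (B : E →L[ℝ] E) (t : ℝ) (f : E) :
    HasSum (fun k : ℕ => (t ^ k / (k.factorial : ℝ)) • φ ((B ^ k) f))
      (φ (semigroup B t f)) := by
  have h := NormedSpace.exp_series_hasSum_exp' (𝕂 := ℝ) (t • B)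
  have h2 := h.mapL ((φ.comp (ContinuousLinearMap.apply ℝ E f)))
  convert h2 using 2 with k
  · simp [smul_pow, smul_smul, div_eq_inv_mul]
  · rfl

/-- If a continuous linear map kills the iterates `L f, L² f, …`, then it is constant along the
orbit of `f` under the semigroup. -/
theorem map_semigroup_of_map_pow_eq_zero {E F : Type*} [NormedAddCommGroup E] [NormedSpace ℝ E]
    [CompleteSpace E] [NormedAddCommGroup F] [NormedSpace ℝ F] (φ : E →L[ℝ] F) (L : E →L[ℝ] E)
    (f : E) (h : ∀ k : ℕ, φ ((L ^ (k + 1)) f) = 0) (t : ℝ) : φ (semigroup L t f) = φ f := by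
  refine (hasSum_semigroup_apply φ L t f).unique ?_
  have h1 := hasSum_single (f := fun k : ℕ => (t ^ k / (k.factorial : ℝ)) • φ ((L ^ k) f)) 0
    (fun k hk => by
      obtain ⟨j, rfl⟩ := Nat.exists_eq_succ_of_ne_zero hk
      rw [h, smul_zero])
  simpa using h1

/-- Uniformization: scalars commute with everything, so the shift by a factors out of the
exponential. For a Markov generator with a suitable a the shifted operator is positive, and its
series has nonnegative terms on nonnegative functions. -/
theorem semigroup_eq_smul_semigroup {E : Type*} [NormedAddCommGroup E] [NormedSpace ℝ E]
    [CompleteSpace E] (L : E →L[ℝ] E) (a t : ℝ) :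
    semigroup L t = Real.exp (-(t * a)) • semigroup (L + a • 1) t := by
  let _ : NormedAlgebra ℚ (E →L[ℝ] E) := NormedAlgebra.restrictScalars ℚ ℝ _
  have h1 : t • L = algebraMap ℝ (E →L[ℝ] E) (-(t * a)) + t • (L + a • 1) := by
    rw [Algebra.algebraMap_eq_smul_one, smul_add, smul_smul, neg_smul]
    abel
  rw [semigroup, semigroup, h1, NormedSpace.exp_add_of_commute (Algebra.commutes _ _),
    ← NormedSpace.algebraMap_exp_comm, Real.exp_eq_exp_ℝ, ← Algebra.smul_def]

theorem hasDerivAt_semigroup_apply_zero {E : Type*} [NormedAddCommGroup E] [NormedSpace ℝ E]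
    [CompleteSpace E] (L : E →L[ℝ] E) (f : E) :
    HasDerivAt (fun t => semigroup L t f) (L f) 0 := by
  have h := hasDerivAt_exp_smul_const (𝕂 := ℝ) L 0
  have h2 := ((ContinuousLinearMap.apply ℝ E f).hasFDerivAt.comp_hasDerivAt (0 : ℝ) h)
  simpa [Function.comp_def, semigroup] using h2

end Semigroup

/-! ### Markov semigroups and convergence under Doeblin's condition -/

section Markov

variable {X : Type*} [TopologicalSpace X]

/-- `L` is a bounded Markov generator with total jump rate at most `a`. -/
structure IsMarkovGenerator (L : (X →ᵇ ℝ) →L[ℝ] (X →ᵇ ℝ)) (a : ℝ) : Prop where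
  map_const : ∀ c : ℝ, L (BoundedContinuousFunction.const X c) = 0
  nonneg : ∀ f : X →ᵇ ℝ, (∀ z, 0 ≤ f z) → ∀ z, 0 ≤ L f z + a * f z

/-- Some iterate of `B` at `z` dominates a positive multiple of the evaluation at `w`. -/
def Minorizes (B : (X →ᵇ ℝ) →L[ℝ] (X →ᵇ ℝ)) (z w : X) : Prop :=
  ∃ ε : ℝ, 0 < ε ∧ ∃ N : ℕ, ∀ f : X →ᵇ ℝ, (∀ z, 0 ≤ f z) → ε * f w ≤ (B ^ N) f z

namespace IsMarkovGenerator

variable {L : (X →ᵇ ℝ) →L[ℝ] (X →ᵇ ℝ)} {a : ℝ} (hL : IsMarkovGenerator L a)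
include hL

theorem pow_nonneg {f : X →ᵇ ℝ} (hf : ∀ z, 0 ≤ f z) (N : ℕ) :
    ∀ z, 0 ≤ ((L + a • 1) ^ N) f z := by
  induction N with
  | zero => simpa using hf
  | succ N ih =>
    intro z
    rw [pow_succ']
    simpa using hL.nonneg _ ih z

theorem le_semigroup_add_smul_one {f : X →ᵇ ℝ} (hf : ∀ z, 0 ≤ f z) {t : ℝ} (ht : 0 ≤ t) (N : ℕ) (z : X) :
    t ^ N / (N.factorial : ℝ) * ((L + a • 1) ^ N) f z ≤
      semigroup (L + a • 1) t f z := by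
  have h := hasSum_semigroup_apply (BoundedContinuousFunction.evalCLM ℝ z) (L + a • 1) t f
  refine le_hasSum h N fun k _ => ?_
  exact mul_nonneg (by positivity) (hL.pow_nonneg hf k z)

/-- A series of nonnegative terms dominates each of them, so a path of N transitions suffices to
bound the semigroup from below. -/
theorem semigroup_ge {f : X →ᵇ ℝ} (hf : ∀ z, 0 ≤ f z) {t : ℝ} (ht : 0 ≤ t) (N : ℕ) (z : X) :
    Real.exp (-(t * a)) * (t ^ N / (N.factorial : ℝ) * ((L + a • 1) ^ N) f z) ≤
      semigroup L t f z := by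
  rw [semigroup_eq_smul_semigroup L a t]
  exact mul_le_mul_of_nonneg_left (hL.le_semigroup_add_smul_one hf ht N z) (Real.exp_pos _).le

theorem semigroup_nonneg {f : X →ᵇ ℝ} (hf : ∀ z, 0 ≤ f z) {t : ℝ} (ht : 0 ≤ t) (z : X) :
    0 ≤ semigroup L t f z :=
  le_trans (mul_nonneg (Real.exp_pos _).le (mul_nonneg (by positivity) (hL.pow_nonneg hf 0 z)))
    (hL.semigroup_ge hf ht 0 z)

theorem semigroup_const (t c : ℝ) : semigroup L t (BoundedContinuousFunction.const X c) =
    BoundedContinuousFunction.const X c :=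
  map_semigroup_of_map_pow_eq_zero (ContinuousLinearMap.id ℝ _) L _
    (fun k => by simp [pow_succ, hL.map_const c]) t

theorem semigroup_mono {f g : X →ᵇ ℝ} (hfg : ∀ z, f z ≤ g z) {t : ℝ} (ht : 0 ≤ t) (z : X) :
    semigroup L t f z ≤ semigroup L t g z := by
  have := hL.semigroup_nonneg (f := g - f) (fun z => by simpa using hfg z) ht z
  simpa using this

theorem minorizes_trans {x y z : X} (h1 : Minorizes (L + a • 1) x y)
    (h2 : Minorizes (L + a • 1) y z) : Minorizes (L + a • 1) x z := by
  obtain ⟨ε, hε, N, h⟩ := h1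
  obtain ⟨δ, hδ, K, h'⟩ := h2
  refine ⟨ε * δ, by positivity, N + K, fun f hf => ?_⟩
  calc ε * δ * f z = ε * (δ * f z) := by ring
    _ ≤ ε * ((L + a • 1) ^ K) f y := by gcongr; exact h' f hf
    _ ≤ ((L + a • 1) ^ N) (((L + a • 1) ^ K) f) x := h _ (hL.pow_nonneg hf K)
    _ = _ := by rw [pow_add]; rfl

omit hL in
theorem minorizes_refl (B : (X →ᵇ ℝ) →L[ℝ] (X →ᵇ ℝ)) (z : X) : Minorizes B z z :=
  ⟨1, one_pos, 0, fun f _ => by simp⟩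

/-- Doeblin's condition contracts the oscillation. -/
theorem semigroup_one_bounds {ε : ℝ} {z₀ : X}
    (hD : ∀ f : X →ᵇ ℝ, (∀ z, 0 ≤ f z) → ∀ z, ε * f z₀ ≤ semigroup L 1 f z)
    {f : X →ᵇ ℝ} {l u : ℝ} (hl : ∀ z, l ≤ f z) (hu : ∀ z, f z ≤ u) :
    ∃ l' u' : ℝ, u' - l' = (1 - ε) * (u - l) ∧
      ∀ z, l' ≤ semigroup L 1 f z ∧ semigroup L 1 f z ≤ u' := by
  -- These bounds come from Doeblin's condition applied to the nonnegative functions f - l and u -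
  -- f; the value f z₀ cancels in their difference.
  refine ⟨l + ε * (f z₀ - l), u - ε * (u - f z₀), by ring, fun z => ⟨?_, ?_⟩⟩
  · have := hD (f - BoundedContinuousFunction.const X l) (fun z => by simpa using hl z) z
    simp only [map_sub, hL.semigroup_const, BoundedContinuousFunction.sub_apply,
      BoundedContinuousFunction.const_apply] at this
    linarith
  · have := hD (BoundedContinuousFunction.const X u - f) (fun z => by simpa using hu z) z
    simp only [map_sub, hL.semigroup_const, BoundedContinuousFunction.sub_apply,
      BoundedContinuousFunction.const_apply] at this
    linarith

/-- Each unit of time contracts the oscillation by 1 - ε. Bounds reached at time k persist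
afterwards, because the semigroup is monotone and fixes constants. -/
theorem semigroup_nat_bounds {ε : ℝ} {z₀ : X}
    (hD : ∀ f : X →ᵇ ℝ, (∀ z, 0 ≤ f z) → ∀ z, ε * f z₀ ≤ semigroup L 1 f z)
    (f : X →ᵇ ℝ) (k : ℕ) :
    ∃ l u : ℝ, u - l = (1 - ε) ^ k * (2 * ‖f‖) ∧
      ∀ t : ℝ, k ≤ t → ∀ z, l ≤ semigroup L t f z ∧ semigroup L t f z ≤ u := by
  have base : ∃ l u : ℝ, u - l = (1 - ε) ^ k * (2 * ‖f‖) ∧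
      ∀ z, l ≤ semigroup L k f z ∧ semigroup L k f z ≤ u := by
    induction k with
    | zero =>
      refine ⟨-‖f‖, ‖f‖, by ring, fun z => ?_⟩
      have : semigroup L ((0 : ℕ) : ℝ) f = f := by simp [semigroup]
      rw [this]
      exact abs_le.1 (f.norm_coe_le_norm z)
    | succ k ih =>
      obtain ⟨l, u, hlu, h⟩ := ih
      obtain ⟨l', u', h1, h2⟩ := hL.semigroup_one_bounds hD (fun z => (h z).1) (fun z => (h z).2)
      refine ⟨l', u', by rw [h1, hlu]; ring, fun z => ?_⟩
      have : semigroup L ((k + 1 : ℕ) : ℝ) f = semigroup L 1 (semigroup L k f) := by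
        rw [show ((k + 1 : ℕ) : ℝ) = 1 + k by push_cast; ring, semigroup_add]
        rfl
      rw [this]
      exact h2 z
  obtain ⟨l, u, hlu, h⟩ := base
  refine ⟨l, u, hlu, fun t ht z => ?_⟩
  have hs : semigroup L t f = semigroup L (t - k) (semigroup L k f) := by
    conv_lhs => rw [show t = (t - k) + k by ring, semigroup_add]
    rfl
  have ht' : 0 ≤ t - k := by linarith
  rw [hs]
  constructor
  · simpa [hL.semigroup_const] using hL.semigroup_mono
      (f := BoundedContinuousFunction.const X l) (fun z => (h z).1) ht' z
  · simpa [hL.semigroup_const] using hL.semigroup_mono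
      (g := BoundedContinuousFunction.const X u) (fun z => (h z).2) ht' z

theorem exists_tendsto_const {ε : ℝ} (hε : 0 < ε) {z₀ : X}
    (hD : ∀ f : X →ᵇ ℝ, (∀ z, 0 ≤ f z) → ∀ z, ε * f z₀ ≤ semigroup L 1 f z) (f : X →ᵇ ℝ) :
    ∃ v : ℝ, Tendsto (fun t => semigroup L t f) atTop
      (𝓝 (BoundedContinuousFunction.const X v)) := by
  -- Doeblin's condition tested on the constant 1; the geometric decay needs 0 ≤ 1 - ε.
  have hε1 : ε ≤ 1 := by
    have := hD (BoundedContinuousFunction.const X 1) (fun z => by simp) z₀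
    simpa [hL.semigroup_const] using this
  have hsmall : ∀ δ : ℝ, 0 < δ → ∃ k : ℕ, (1 - ε) ^ k * (2 * ‖f‖) < δ := by
    intro δ hδ
    have h := (tendsto_pow_atTop_nhds_zero_of_lt_one (r := 1 - ε) (by linarith)
      (by linarith)).mul_const (2 * ‖f‖)
    rw [zero_mul] at h
    exact (h.eventually (gt_mem_nhds hδ)).exists
  have hcauchy : CauchySeq fun t : ℝ => semigroup L t f z₀ := by
    refine Metric.cauchySeq_iff.2 fun δ hδ => ?_
    obtain ⟨k, hk⟩ := hsmall δ hδ
    obtain ⟨l, u, hlu, h⟩ := hL.semigroup_nat_bounds hD f k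
    refine ⟨k, fun s hs t ht => ?_⟩
    rw [Real.dist_eq, abs_lt]
    constructor <;> linarith [(h s hs z₀).1, (h s hs z₀).2, (h t ht z₀).1, (h t ht z₀).2]
  obtain ⟨v, hv⟩ := cauchySeq_tendsto_of_complete hcauchy
  refine ⟨v, Metric.tendsto_atTop.2 fun δ hδ => ?_⟩
  obtain ⟨k, hk⟩ := hsmall (δ / 2) (by linarith)
  obtain ⟨l, u, hlu, h⟩ := hL.semigroup_nat_bounds hD f k
  have hlv : l ≤ v := ge_of_tendsto hv
    ((eventually_ge_atTop (k : ℝ)).mono fun t ht => (h t ht z₀).1)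
  have huv : v ≤ u := le_of_tendsto hv
    ((eventually_ge_atTop (k : ℝ)).mono fun t ht => (h t ht z₀).2)
  refine ⟨k, fun t ht => lt_of_le_of_lt ?_ (half_lt_self hδ)⟩
  refine (BoundedContinuousFunction.dist_le (by linarith)).2 fun z => ?_
  rw [Real.dist_eq, BoundedContinuousFunction.const_apply, abs_le]
  constructor <;> linarith [(h t ht z).1, (h t ht z).2]

/-- Under Doeblin's condition the semigroup converges to an invariant mean. -/
theorem exists_invariant_mean {ε : ℝ} (hε : 0 < ε) {z₀ : X}
    (hD : ∀ f : X →ᵇ ℝ, (∀ z, 0 ≤ f z) → ∀ z, ε * f z₀ ≤ semigroup L 1 f z) :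
    ∃ ν : (X →ᵇ ℝ) →L[ℝ] ℝ,
      (∀ f, Tendsto (fun t => semigroup L t f) atTop
        (𝓝 (BoundedContinuousFunction.const X (ν f)))) ∧
      (∀ f g : X →ᵇ ℝ, (∀ z, f z ≤ g z) → ν f ≤ ν g) ∧
      (∀ c : ℝ, ν (BoundedContinuousFunction.const X c) = c) ∧
      ∀ f, ν (L f) = 0 := by
  choose v hv using hL.exists_tendsto_const hε hD
  have hpt : ∀ f, Tendsto (fun t => semigroup L t f z₀) atTop (𝓝 (v f)) := fun f => by
    simpa [Function.comp_def] using
      ((BoundedContinuousFunction.evalCLM ℝ z₀).continuous.tendsto _).comp (hv f)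
  have hmono : ∀ f g : X →ᵇ ℝ, (∀ z, f z ≤ g z) → v f ≤ v g := fun f g hfg =>
    le_of_tendsto_of_tendsto (hpt f) (hpt g)
      ((eventually_ge_atTop (0 : ℝ)).mono fun t ht => hL.semigroup_mono hfg ht z₀)
  have hconst : ∀ c : ℝ, v (BoundedContinuousFunction.const X c) = c := fun c =>
    tendsto_nhds_unique (hpt _) (by simp [hL.semigroup_const])
  -- Linearity passes to the limit at z₀; the norm bound 1 follows from monotonicity and -‖f‖ ≤ f ≤
  -- ‖f‖.
  let ν : (X →ᵇ ℝ) →L[ℝ] ℝ := LinearMap.mkContinuous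
    { toFun := v
      map_add' := fun f g => tendsto_nhds_unique (hpt _) (by simpa using (hpt f).add (hpt g))
      map_smul' := fun c f => tendsto_nhds_unique (hpt _)
        (by simpa using (hpt f).const_mul c) } 1
    (fun f => by
      rw [one_mul, Real.norm_eq_abs, abs_le]
      constructor
      · rw [← hconst (-‖f‖)]
        exact hmono _ _ fun z => (abs_le.1 (f.norm_coe_le_norm z)).1
      · conv_rhs => rw [← hconst ‖f‖]
        exact hmono _ _ fun z => (abs_le.1 (f.norm_coe_le_norm z)).2)
  refine ⟨ν, hv, hmono, hconst, fun f => ?_⟩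
  have hinv : ∀ s, ν (semigroup L s f) = ν f := fun s => by
    refine tendsto_nhds_unique (hpt (semigroup L s f)) ?_
    have h1 := (hpt f).comp (tendsto_atTop_add_const_right atTop s tendsto_id)
    refine h1.congr fun t => ?_
    simp only [Function.comp, id]
    rw [semigroup_add]
    rfl
  -- The function s ↦ ν(exp(sL) f) is constant, and its derivative at 0 is ν(L f).
  have h1 := ν.hasFDerivAt.comp_hasDerivAt (0 : ℝ) (hasDerivAt_semigroup_apply_zero L f)
  have h2 : (⇑ν ∘ fun t => semigroup L t f) = fun _ => ν f := funext hinv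
  rw [h2] at h1
  exact h1.unique (hasDerivAt_const _ _)

end IsMarkovGenerator

end Markov

variable {n M : ℕ}

/-! ### Doeblin's condition for the network -/

section Ergodicity

/-- A bound on the total transition rate of the network. -/
noncomputable def rateBound (n : ℕ) (Q : Matrix (Fin M) (Fin M) ℝ) (lam ls : ℝ) : ℝ :=
  (∑ i, ∑ r, |Q i r|) + (∑ _j : Fin n, ls / n)
    + ∑ i : Fin n, ∑ _j ∈ Finset.univ.erase i, lam / ((n : ℝ) - 1)

theorem sum_jumpRate_le (Q : Matrix (Fin M) (Fin M) ℝ) (i : Fin M) :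
    ∑ r, (if i = r then 0 else Q i r) ≤ ∑ i, ∑ r, |Q i r| :=
  calc ∑ r, (if i = r then 0 else Q i r) ≤ ∑ r, |Q i r| :=
        Finset.sum_le_sum fun r _ => by split_ifs; exacts [abs_nonneg _, le_abs_self _]
    _ ≤ _ := Finset.single_le_sum (f := fun i => ∑ r, |Q i r|)
        (fun i _ => Finset.sum_nonneg fun r _ => abs_nonneg _) (Finset.mem_univ i)

/-- The push and gossip rates do not depend on the state, so the shift cancels their diagonal part
exactly. The jump rates do, which leaves the last term, with a nonnegative coefficient by
`sum_jumpRate_le`. -/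
theorem generator_add_apply (Q : Matrix (Fin M) (Fin M) ℝ) (lam ls : ℝ) (f : State n M →ᵇ ℝ)
    (z : State n M) :
    generator n Q lam ls f z + rateBound n Q lam ls * f z =
      (∑ r, (if z.src = r then 0 else Q z.src r) * f (z.jump r))
      + (∑ j, ls / n * f (z.push j))
      + (∑ i, ∑ j ∈ Finset.univ.erase i, lam / ((n : ℝ) - 1) * f (z.gossip i j))
      + ((∑ i, ∑ r, |Q i r|) - ∑ r, (if z.src = r then 0 else Q z.src r)) * f z := by
  rw [generator_apply, rateBound]
  simp only [mul_sub, Finset.sum_sub_distrib, ← Finset.sum_mul]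
  ring

variable {Q : Matrix (Fin M) (Fin M) ℝ} {lam ls : ℝ}

theorem IsGenerator.jumpRate_nonneg (hQ : IsGenerator Q) (i r : Fin M) :
    0 ≤ if i = r then 0 else Q i r := by
  split_ifs with h
  exacts [le_rfl, hQ.off_diag_nonneg i r h]

/-- For n = 1 the quotient is 0 by convention, and there is no pair of nodes to use it. -/
theorem gossipRate_nonneg (hn : 1 ≤ n) (hlam : 0 ≤ lam) : 0 ≤ lam / ((n : ℝ) - 1) :=
  div_nonneg hlam (sub_nonneg.2 (by exact_mod_cast hn))

theorem generator_add_apply_ge (hQ : IsGenerator Q) (hn : 1 ≤ n) (hlam : 0 ≤ lam) (hls : 0 ≤ ls)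
    {f : State n M →ᵇ ℝ} (hf : ∀ z, 0 ≤ f z) (z : State n M) :
    0 ≤ generator n Q lam ls f z + rateBound n Q lam ls * f z ∧
    (∀ r, (if z.src = r then 0 else Q z.src r) * f (z.jump r) ≤
      generator n Q lam ls f z + rateBound n Q lam ls * f z) ∧
    ∀ j, ls / n * f (z.push j) ≤ generator n Q lam ls f z + rateBound n Q lam ls * f z := by
  rw [generator_add_apply]
  have h1 : ∀ r ∈ Finset.univ, 0 ≤ (if z.src = r then 0 else Q z.src r) * f (z.jump r) :=
    fun r _ => mul_nonneg (hQ.jumpRate_nonneg _ _) (hf _)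
  have h2 : ∀ j ∈ Finset.univ, 0 ≤ ls / n * f (z.push j) := fun j _ =>
    mul_nonneg (div_nonneg hls n.cast_nonneg) (hf _)
  have h3 : 0 ≤ ∑ i, ∑ j ∈ Finset.univ.erase i, lam / ((n : ℝ) - 1) * f (z.gossip i j) :=
    Finset.sum_nonneg fun i _ => Finset.sum_nonneg fun j _ =>
      mul_nonneg (gossipRate_nonneg hn hlam) (hf _)
  have h4 : 0 ≤ ((∑ i, ∑ r, |Q i r|) - ∑ r, (if z.src = r then 0 else Q z.src r)) * f z :=
    mul_nonneg (sub_nonneg.2 (sum_jumpRate_le Q z.src)) (hf z)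
  have h1' := Finset.sum_nonneg h1
  have h2' := Finset.sum_nonneg h2
  refine ⟨by positivity, fun r => ?_, fun j => ?_⟩
  · have := Finset.single_le_sum h1 (Finset.mem_univ r)
    linarith
  · have := Finset.single_le_sum h2 (Finset.mem_univ j)
    linarith

theorem isMarkovGenerator_generator (hQ : IsGenerator Q) (hn : 1 ≤ n) (hlam : 0 ≤ lam)
    (hls : 0 ≤ ls) : IsMarkovGenerator (generator n Q lam ls) (rateBound n Q lam ls) where
  map_const c := by
    ext z
    rw [generator_apply]
    simp
  nonneg _ hf z := (generator_add_apply_ge hQ hn hlam hls hf z).1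

/-- The state in which every node stores the current version of the source. -/
def State.fresh (n : ℕ) (i : Fin M) : State n M where
  src := i
  age := fun _ => 0
  content := fun _ => i
  content_of_age_eq_zero := fun _ _ => rfl
  content_of_age_eq := fun _ _ _ => rfl

theorem State.foldl_push (l : List (Fin n)) (z : State n M) :
    (l.foldl (fun z j => z.push j) z).src = z.src ∧
    ∀ j, ((l.foldl (fun z j => z.push j) z).age j = if j ∈ l then 0 else z.age j) ∧
      ((l.foldl (fun z j => z.push j) z).content j = if j ∈ l then z.src else z.content j) := by
  induction l generalizing z with
  | nil => simp
  | cons a l ih =>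
    obtain ⟨h1, h2⟩ := ih (z.push a)
    refine ⟨h1, fun j => ?_⟩
    obtain ⟨h3, h4⟩ := h2 j
    rw [List.foldl_cons, h3, h4]
    by_cases hja : j = a
    · subst hja
      simp [State.push]
    · simp [State.push, hja]

theorem State.foldl_push_finRange (z : State n M) :
    (List.finRange n).foldl (fun z j => z.push j) z = State.fresh n z.src := by
  obtain ⟨h1, h2⟩ := State.foldl_push (List.finRange n) z
  ext j
  · rw [h1]; rfl
  · rw [(h2 j).1]; simp [State.fresh]
  · rw [(h2 j).2]; simp [State.fresh]

theorem foldl_push_pow (hQ : IsGenerator Q) (hn : 1 ≤ n) (hlam : 0 ≤ lam) (hls : 0 < ls)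
    {f : State n M →ᵇ ℝ} (hf : ∀ z, 0 ≤ f z) (l : List (Fin n)) (z : State n M) :
    (ls / n) ^ l.length * f (l.foldl (fun z j => z.push j) z) ≤
      ((generator n Q lam ls + rateBound n Q lam ls • 1) ^ l.length) f z := by
  have hL := isMarkovGenerator_generator hQ hn hlam hls.le
  induction l generalizing z with
  | nil => simp
  | cons a l ih =>
    have h0 : 0 ≤ ls / n := by positivity
    rw [List.length_cons, pow_succ', pow_succ', mul_assoc]
    exact (mul_le_mul_of_nonneg_left (ih (z.push a)) h0).trans
      ((generator_add_apply_ge hQ hn hlam hls.le (hL.pow_nonneg hf l.length) z).2.2 a)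

theorem minorizes_fresh (hQ : IsGenerator Q) (hn : 1 ≤ n) (hlam : 0 ≤ lam) (hls : 0 < ls)
    (z : State n M) :
    Minorizes (generator n Q lam ls + rateBound n Q lam ls • 1) z (State.fresh n z.src) := by
  refine ⟨(ls / n) ^ n, by positivity, n, fun f hf => ?_⟩
  have h := foldl_push_pow hQ hn hlam hls hf (List.finRange n) z
  rwa [State.foldl_push_finRange, List.length_finRange] at h

theorem minorizes_fresh_fresh (hQ : IsGenerator Q) (hirr : IsIrreducibleGenerator Q) (hn : 1 ≤ n)
    (hlam : 0 ≤ lam) (hls : 0 < ls) (i j : Fin M) :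
    Minorizes (generator n Q lam ls + rateBound n Q lam ls • 1) (State.fresh n i)
      (State.fresh n j) := by
  have hL := isMarkovGenerator_generator hQ hn hlam hls.le
  induction hirr i j with
  | refl => exact IsMarkovGenerator.minorizes_refl _ _
  | @tail b c _ hbc ih =>
    -- Along a path of source states, each jump makes every node stale; a round of pushes then
    -- restores a fresh state.
    refine hL.minorizes_trans ih (hL.minorizes_trans (y := (State.fresh n b).jump c)
      ⟨Q b c, hbc.2, 1, fun f hf => ?_⟩ (minorizes_fresh hQ hn hlam hls _))
    have := (generator_add_apply_ge hQ hn hlam hls.le hf (State.fresh n b)).2.1 c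
    rw [if_neg (show (State.fresh n b).src ≠ c from hbc.1)] at this
    rw [pow_one]
    exact this

/-- Doeblin's condition for the network process. -/
theorem exists_doeblin (hQ : IsGenerator Q) (hirr : IsIrreducibleGenerator Q) (hn : 1 ≤ n)
    (hlam : 0 ≤ lam) (hls : 0 < ls) (m : Fin M) :
    ∃ ε : ℝ, 0 < ε ∧ ∀ f : State n M →ᵇ ℝ, (∀ z, 0 ≤ f z) → ∀ z,
      ε * f (State.fresh n m) ≤ semigroup (generator n Q lam ls) 1 f z := by
  have hL := isMarkovGenerator_generator hQ hn hlam hls.le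
  have key : ∀ i : Fin M, ∃ ε : ℝ, 0 < ε ∧ ∀ f : State n M →ᵇ ℝ, (∀ z, 0 ≤ f z) →
      ∀ z : State n M, z.src = i →
        ε * f (State.fresh n m) ≤ semigroup (generator n Q lam ls) 1 f z := by
    intro i
    obtain ⟨ε, hε, N, h⟩ := minorizes_fresh_fresh hQ hirr hn hlam hls i m
    -- The series term of order n + N: n pushes lead to `fresh n i`, and N further steps to `fresh n
    -- m`. The constant depends on z only through its source state, so a minimum over finitely many
    -- values serves the infinite state space.
    refine ⟨Real.exp (-(1 * rateBound n Q lam ls)) *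
      (1 ^ (n + N) / ((n + N).factorial : ℝ) * ((ls / n) ^ n * ε)), by positivity,
      fun f hf z hz => ?_⟩
    refine le_trans ?_ (hL.semigroup_ge hf zero_le_one (n + N) z)
    rw [mul_assoc, mul_assoc, mul_assoc]
    gcongr
    rw [pow_add]
    have h1 := foldl_push_pow hQ hn hlam hls (hL.pow_nonneg hf N) (List.finRange n) z
    rw [State.foldl_push_finRange, List.length_finRange, hz] at h1
    refine le_trans ?_ h1
    gcongr
    exact h f hf
  choose ε hε h using key
  have : Nonempty (Fin M) := ⟨m⟩
  obtain ⟨i, hi⟩ := Finite.exists_min ε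
  refine ⟨ε i, hε i, fun f hf z => le_trans ?_ (h z.src f hf z rfl)⟩
  exact mul_le_mul_of_nonneg_right (hi _) (hf _)

end Ergodicity

/-! ### Symmetry under relabelling of the nodes -/

section Exchangeability

/-- Relabelling of the nodes. -/
def State.permute (σ : Equiv.Perm (Fin n)) (z : State n M) : State n M where
  src := z.src
  age := z.age ∘ σ
  content := z.content ∘ σ
  content_of_age_eq_zero := fun i h => z.content_of_age_eq_zero (σ i) h
  content_of_age_eq := fun i j h => z.content_of_age_eq (σ i) (σ j) h

theorem State.push_permute (σ : Equiv.Perm (Fin n)) (j : Fin n) (z : State n M) :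
    (z.permute σ).push j = (z.push (σ j)).permute σ := by
  ext i
  · rfl
  all_goals by_cases h : i = j <;> simp [State.push, State.permute, h]

theorem State.gossip_permute (σ : Equiv.Perm (Fin n)) (i j : Fin n) (z : State n M) :
    (z.permute σ).gossip i j = (z.gossip (σ i) (σ j)).permute σ := by
  have hc : (z.permute σ).copy i j = (z.copy (σ i) (σ j)).permute σ := by
    ext a
    · rfl
    all_goals by_cases h : a = j <;> simp [State.copy, State.permute, h]
  by_cases h : z.age (σ i) < z.age (σ j)
  · rw [State.gossip, if_pos (show (z.permute σ).age i < (z.permute σ).age j from h),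
      State.gossip, if_pos h, hc]
  · rw [State.gossip, if_neg (show ¬(z.permute σ).age i < (z.permute σ).age j from h),
      State.gossip, if_neg h]

/-- The rates are the same for all nodes and all ordered pairs, so a relabelling only reorders the
sums. -/
theorem commute_compReset_permute_generator (Q : Matrix (Fin M) (Fin M) ℝ) (lam ls : ℝ)
    (σ : Equiv.Perm (Fin n)) :
    Commute (compReset (State.permute σ)) (generator n Q lam ls) := by
  refine ContinuousLinearMap.ext fun f => BoundedContinuousFunction.ext fun z => ?_
  change generator n Q lam ls f (z.permute σ) =
    generator n Q lam ls (compReset (State.permute σ) f) z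
  rw [generator_apply, generator_apply]
  simp only [compReset_apply, State.push_permute, State.gossip_permute]
  congr 1
  · congr 1
    exact Equiv.sum_comp σ fun j => ls / n * (f ((z.push j).permute σ) - f (z.permute σ))
  · rw [← Equiv.sum_comp σ fun i => ∑ j ∈ Finset.univ.erase i, lam / ((n : ℝ) - 1) *
      (f ((z.gossip i j).permute σ) - f (z.permute σ))]
    exact Finset.sum_congr rfl fun i _ => Finset.sum_equiv σ (by simp) fun j _ => rfl

theorem semigroup_compReset_permute (Q : Matrix (Fin M) (Fin M) ℝ) (lam ls t : ℝ)
    (σ : Equiv.Perm (Fin n)) (f : State n M →ᵇ ℝ) (z : State n M) :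
    semigroup (generator n Q lam ls) t (compReset (State.permute σ) f) z =
      semigroup (generator n Q lam ls) t f (z.permute σ) := by
  have h : Commute (compReset (State.permute σ)) (semigroup (generator n Q lam ls) t) :=
    commute_semigroup (commute_compReset_permute_generator Q lam ls σ) t
  exact (DFunLike.congr_fun (DFunLike.congr_fun h.eq f) z).symm

theorem exists_perm_map_eq {A B : Finset (Fin n)} (h : A.card = B.card) :
    ∃ σ : Equiv.Perm (Fin n), A.map σ.toEmbedding = B := by
  let e : {x // x ∈ A} ≃ {x // x ∈ B} := Finset.equivOfCardEq h
  refine ⟨e.extendSubtype, Finset.eq_of_subset_of_card_le ?_ (by rw [Finset.card_map, h])⟩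
  intro x hx
  obtain ⟨y, hy, rfl⟩ := Finset.mem_map.1 hx
  exact e.extendSubtype_mem y hy

theorem State.setAge_eq_zero_iff (z : State n M) (A : Finset (Fin n)) (hA : A.Nonempty) :
    z.setAge A hA = 0 ↔ ∃ j ∈ A, z.age j = 0 := by
  constructor
  · intro h
    obtain ⟨j, hj, hj'⟩ := Finset.exists_mem_eq_inf' hA z.age
    exact ⟨j, hj, hj'.symm.trans h⟩
  · rintro ⟨j, hj, h⟩
    exact Nat.le_zero.1 (h ▸ Finset.inf'_le z.age hj)

theorem freshObs_apply (A : Finset (Fin n)) (hA : A.Nonempty) (m : Fin M) (z : State n M) :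
    freshObs A hA m z = if z.src = m ∧ z.setAge A hA = 0 then 1 else 0 := rfl

theorem accuracyObs_apply (A : Finset (Fin n)) (m : Fin M) (z : State n M) :
    accuracyObs A m z = if z.src = m then z.accuracy A else 0 := rfl

theorem compReset_permute_freshObs (σ : Equiv.Perm (Fin n)) {A B : Finset (Fin n)}
    (hA : A.Nonempty) (hB : B.Nonempty) (h : A.map σ.toEmbedding = B) (m : Fin M) :
    compReset (State.permute σ) (freshObs A hA m) = freshObs B hB m := by
  subst h
  ext z
  simp only [compReset_apply, freshObs_apply, State.setAge_eq_zero_iff, State.permute,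
    Finset.mem_map, exists_exists_and_eq_and, Equiv.coe_toEmbedding, Function.comp_apply]

theorem compReset_permute_accuracyObs (σ : Equiv.Perm (Fin n)) (A : Finset (Fin n)) (m : Fin M) :
    compReset (State.permute σ) (accuracyObs A m) = accuracyObs (A.map σ.toEmbedding) m := by
  ext z
  simp only [compReset_apply, accuracyObs_apply, State.accuracy, State.permute, Finset.sum_map,
    Finset.card_map, Equiv.coe_toEmbedding, Function.comp_apply]

end Exchangeability

/-! ### Source law, staleness, and comparison of observables -/

section Observables

/-- The observable `h(Q)`. -/
noncomputable def srcObs (n : ℕ) (h : Fin M → ℝ) : State n M →ᵇ ℝ :=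
  BoundedContinuousFunction.ofNormedAddCommGroupDiscrete (fun z => h z.src) (∑ i, |h i|)
    (fun z => Finset.single_le_sum (f := fun i => |h i|) (fun _ _ => abs_nonneg _)
      (Finset.mem_univ z.src))

/-- The observable `1{X_j > 0}`. -/
noncomputable def staleObs (M : ℕ) (j : Fin n) : State n M →ᵇ ℝ :=
  BoundedContinuousFunction.ofNormedAddCommGroupDiscrete
    (fun z => if z.age j = 0 then 0 else 1) 1 (fun z => by split_ifs <;> simp)

theorem srcObs_apply (h : Fin M → ℝ) (z : State n M) : srcObs n h z = h z.src := rfl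

theorem staleObs_apply (j : Fin n) (z : State n M) :
    staleObs M j z = if z.age j = 0 then 0 else 1 := rfl

/-- The source evolves autonomously: pushes and gossip leave it unchanged. -/
theorem generator_srcObs {Q : Matrix (Fin M) (Fin M) ℝ} (hQ : IsGenerator Q) (lam ls : ℝ)
    (h : Fin M → ℝ) : generator n Q lam ls (srcObs n h) = srcObs n (Q.mulVec h) := by
  ext z
  rw [generator_apply]
  have h1 : ∀ j, (z.push j).src = z.src := fun _ => rfl
  have h2 : ∀ i j, (z.gossip i j).src = z.src := fun i j => by
    unfold State.gossip; split_ifs <;> rfl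
  have h3 : ∀ r, (z.jump r).src = r := fun _ => rfl
  simp only [srcObs_apply, h1, h2, h3, sub_self, mul_zero, Finset.sum_const_zero, add_zero]
  have h4 : ∀ r, (if z.src = r then 0 else Q z.src r) * (h r - h z.src) =
      Q z.src r * h r - Q z.src r * h z.src := fun r => by
    split_ifs with hr
    · rw [hr]; ring
    · ring
  simp only [h4, Finset.sum_sub_distrib, ← Finset.sum_mul, hQ.row_sum, zero_mul, sub_zero]
  rfl

/-- The law of the source does not change in time if it is stationary. -/
theorem stationary_semigroup_srcObs {Q : Matrix (Fin M) (Fin M) ℝ} (hQ : IsGenerator Q)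
    {p : Fin M → ℝ} (hp : IsStationary Q p) (lam ls t : ℝ) (h : Fin M → ℝ) :
    ∑ i, p i * semigroup (generator n Q lam ls) t (srcObs n h) (State.fresh n i) =
      ∑ i, p i * h i := by
  -- The initial law with source distributed as p and all nodes fresh. Positive iterates of the
  -- generator on h(Q) have the form (Q h')(Q), which p annihilates.
  let φ : (State n M →ᵇ ℝ) →L[ℝ] ℝ :=
    ∑ i, p i • BoundedContinuousFunction.evalCLM ℝ (State.fresh n i)
  have hφ : ∀ f, φ f = ∑ i, p i * f (State.fresh n i) := fun f => by
    simp [φ]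
  have hpow : ∀ k : ℕ, ∃ h', ((generator n Q lam ls) ^ k) (srcObs n h) = srcObs n h' := by
    intro k
    induction k with
    | zero => exact ⟨h, rfl⟩
    | succ k ih =>
      obtain ⟨h', hh'⟩ := ih
      exact ⟨Q.mulVec h', by rw [pow_succ', ← generator_srcObs hQ lam ls, ← hh']; rfl⟩
  have key := map_semigroup_of_map_pow_eq_zero φ (generator n Q lam ls) (srcObs n h)
    (fun k => by
      obtain ⟨h', hh'⟩ := hpow k
      have : ((generator n Q lam ls) ^ (k + 1)) (srcObs n h) = srcObs n (Q.mulVec h') := by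
        rw [pow_succ', ← generator_srcObs hQ lam ls, ← hh']; rfl
      rw [this, hφ]
      change p ⬝ᵥ (Q.mulVec h') = 0
      rw [Matrix.dotProduct_mulVec, hp.2, zero_dotProduct]) t
  rw [hφ, hφ] at key
  exact key

/-- A drift inequality: source jumps raise the indicator at a bounded rate, a push to j resets it,
and the other transitions never raise it. -/
theorem generator_staleObs_le {Q : Matrix (Fin M) (Fin M) ℝ} (hQ : IsGenerator Q) (hn : 1 ≤ n)
    {lam ls : ℝ} (hlam : 0 ≤ lam) (hls : 0 ≤ ls) (j : Fin n) (z : State n M) :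
    generator n Q lam ls (staleObs M j) z ≤
      (∑ i, ∑ r, |Q i r|) - ls / n * staleObs M j z := by
  have hle1 : ∀ w : State n M, staleObs M j w ≤ 1 := fun w => by
    rw [staleObs_apply]; split_ifs <;> norm_num
  have h0 : ∀ w : State n M, 0 ≤ staleObs M j w := fun w => by
    rw [staleObs_apply]; split_ifs <;> norm_num
  have hjump : ∑ r, (if z.src = r then 0 else Q z.src r) *
      (staleObs M j (z.jump r) - staleObs M j z) ≤ ∑ i, ∑ r, |Q i r| := by
    refine le_trans (Finset.sum_le_sum fun r _ => ?_) (sum_jumpRate_le Q z.src)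
    refine mul_le_of_le_one_right (hQ.jumpRate_nonneg _ _) ?_
    linarith [hle1 (z.jump r), h0 z]
  have hpush : ∑ i, ls / n * (staleObs M j (z.push i) - staleObs M j z) ≤
      -(ls / n * staleObs M j z) := by
    have h1 : ∀ i, staleObs M j (z.push i) ≤ staleObs M j z := fun i => by
      by_cases hi : j = i
      · refine le_trans (le_of_eq ?_) (h0 z)
        simp [staleObs_apply, State.push, hi]
      · simp [staleObs_apply, State.push, hi]
    have h2 : staleObs M j (z.push j) = 0 := by simp [staleObs_apply, State.push]
    have hnn : 0 ≤ ls / n := by positivity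
    rw [← Finset.add_sum_erase _ _ (Finset.mem_univ j), h2]
    have h3 : ∑ i ∈ Finset.univ.erase j, ls / n * (staleObs M j (z.push i) - staleObs M j z) ≤ 0 :=
      Finset.sum_nonpos fun i _ => mul_nonpos_of_nonneg_of_nonpos hnn (sub_nonpos.2 (h1 i))
    linarith
  have hgossip : ∑ a, ∑ b ∈ Finset.univ.erase a, lam / ((n : ℝ) - 1) *
      (staleObs M j (z.gossip a b) - staleObs M j z) ≤ 0 := by
    refine Finset.sum_nonpos fun a _ => Finset.sum_nonpos fun b _ =>
      mul_nonpos_of_nonneg_of_nonpos (gossipRate_nonneg hn hlam) (sub_nonpos.2 ?_)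
    by_cases hab : z.age a < z.age b
    · rw [State.gossip, if_pos hab]
      by_cases hb : j = b
      -- A node accepts only a strictly smaller age, so a receiver that accepts was already stale.
      · have : z.age j ≠ 0 := by rw [hb]; omega
        rw [staleObs_apply j z, if_neg this]
        exact hle1 _
      · simp [staleObs_apply, State.copy, hb]
    · rw [State.gossip, if_neg hab]
  rw [generator_apply]
  linarith

theorem freshObs_le_srcObs (A : Finset (Fin n)) (hA : A.Nonempty) (m : Fin M) (z : State n M) :
    freshObs A hA m z ≤ srcObs n (Pi.single m 1) z := by
  rw [freshObs_apply, srcObs_apply, Pi.single_apply]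
  by_cases h : z.src = m
  · rw [if_pos h]; split_ifs <;> norm_num
  · simp [h]

theorem srcObs_le_freshObs_add {A : Finset (Fin n)} (hA : A.Nonempty) {j : Fin n} (hj : j ∈ A)
    (m : Fin M) (z : State n M) :
    srcObs n (Pi.single m 1) z ≤ (freshObs A hA m + staleObs M j) z := by
  rw [BoundedContinuousFunction.add_apply, freshObs_apply, srcObs_apply, staleObs_apply,
    Pi.single_apply]
  by_cases h : z.src = m
  · by_cases hz : z.age j = 0
    · have := (z.setAge_eq_zero_iff A hA).2 ⟨j, hj, hz⟩
      simp [h, hz, this]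
    · rw [if_pos h, if_neg hz]
      split_ifs <;> norm_num
  · simp only [h, false_and, if_false]
    split_ifs <;> norm_num

theorem accuracyObs_le_srcObs (A : Finset (Fin n)) (m : Fin M) (z : State n M) :
    accuracyObs A m z ≤ srcObs n (Pi.single m 1) z := by
  rw [accuracyObs_apply, srcObs_apply, Pi.single_apply]
  split_ifs
  exacts [(abs_le.1 (z.abs_accuracy_le A)).2, le_rfl]

/-- A node of age 0 stores the current source state, so the inaccurate fraction of A is at most its
stale fraction. -/
theorem srcObs_le_accuracyObs_add {A : Finset (Fin n)} (hA : A.Nonempty) (m : Fin M)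
    (z : State n M) : srcObs n (Pi.single m 1) z ≤
      (accuracyObs A m + (A.card : ℝ)⁻¹ • ∑ l ∈ A, staleObs M l) z := by
  have hc : (0 : ℝ) < A.card := by exact_mod_cast hA.card_pos
  have hs : 0 ≤ ∑ l ∈ A, staleObs M l z := Finset.sum_nonneg fun l _ => by
    rw [staleObs_apply]; split_ifs <;> norm_num
  have h1 : (A.card : ℝ) ≤ (∑ l ∈ A, if z.content l = z.src then (1 : ℝ) else 0)
      + ∑ l ∈ A, staleObs M l z := by
    rw [← Finset.sum_add_distrib, Finset.card_eq_sum_ones, Nat.cast_sum]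
    refine Finset.sum_le_sum fun l _ => ?_
    rw [staleObs_apply]
    by_cases hl : z.age l = 0
    · simp [hl, z.content_of_age_eq_zero l hl]
    · rw [if_neg hl]; split_ifs <;> norm_num
  simp only [BoundedContinuousFunction.add_apply, BoundedContinuousFunction.smul_apply,
    BoundedContinuousFunction.coe_sum, Finset.sum_apply, smul_eq_mul]
  rw [accuracyObs_apply, srcObs_apply, Pi.single_apply]
  by_cases h : z.src = m
  · rw [if_pos h, if_pos h, State.accuracy, inv_mul_eq_div, ← add_div, le_div_iff₀ hc, one_mul]
    exact h1
  · rw [if_neg h, if_neg h]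
    positivity

end Observables

/-! ### Long-run values and the limit of large source rate -/

/-- The error of the expectation is at most the sup-norm distance to the constant, whatever the
initial law. -/
theorem tendsto_expectation {Q : Matrix (Fin M) (Fin M) ℝ} {lam ls v : ℝ} {f : State n M →ᵇ ℝ}
    (h : Tendsto (fun t => semigroup (generator n Q lam ls) t f) atTop
      (𝓝 (BoundedContinuousFunction.const _ v)))
    (μ : Measure (State n M)) [IsProbabilityMeasure μ] :
    Tendsto (fun t => expectation Q lam ls μ t f) atTop (𝓝 v) := by
  have hint : ∀ f : State n M →ᵇ ℝ, Integrable (fun z => f z) μ := fun f =>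
    Integrable.of_bound (Measurable.aestronglyMeasurable measurable_from_top) ‖f‖
      (Eventually.of_forall f.norm_coe_le_norm)
  refine tendsto_iff_dist_tendsto_zero.2 ?_
  refine squeeze_zero (fun _ => dist_nonneg) (fun t => ?_) (tendsto_iff_dist_tendsto_zero.1 h)
  have hv : v = ∫ _z, v ∂μ := by simp
  rw [Real.dist_eq]
  conv_lhs => rw [hv]
  rw [expectation, transition, ← integral_sub (hint _) (integrable_const v)]
  have := norm_integral_le_of_norm_le_const (μ := μ)
    (f := fun z => semigroup (generator n Q lam ls) t f z - v)
    (C := dist (semigroup (generator n Q lam ls) t f) (BoundedContinuousFunction.const _ v))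
    (Eventually.of_forall fun z => by
      rw [← dist_eq_norm]
      exact BoundedContinuousFunction.dist_coe_le_dist (g := BoundedContinuousFunction.const _ v) z)
  simpa using this

/-- The long-run averages exist, and are close to the stationary distribution of the source when
the source sends its packets at a high rate. -/
theorem exists_limits {Q : Matrix (Fin M) (Fin M) ℝ} (hQ : IsGenerator Q)
    (hirr : IsIrreducibleGenerator Q) {p : Fin M → ℝ} (hp : IsStationary Q p) {lam ls : ℝ}
    (hlam : 0 ≤ lam) (hls : 0 < ls) {k : ℕ} (hk : 1 ≤ k) (hkn : k ≤ n) (m : Fin M) :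
    ∃ g c : ℝ, IsFreshnessLimit n Q lam ls k m g ∧ IsAccuracyLimit n Q lam ls k m c ∧
      |g - p m| ≤ (∑ i, ∑ r, |Q i r|) * n / ls ∧ |c - p m| ≤ (∑ i, ∑ r, |Q i r|) * n / ls := by
  have hn : 1 ≤ n := hk.trans hkn
  have hn0 : (0 : ℝ) < n := by exact_mod_cast hn
  have hL := isMarkovGenerator_generator hQ hn hlam hls.le
  obtain ⟨ε, hε, hD⟩ := exists_doeblin hQ hirr hn hlam hls m
  obtain ⟨ν, hν, hmono, hconst, hinv⟩ := hL.exists_invariant_mean hε hD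
  have hpt : ∀ f z, Tendsto (fun t => semigroup (generator n Q lam ls) t f z) atTop
      (𝓝 (ν f)) := fun f z => by
    simpa [Function.comp_def] using
      ((BoundedContinuousFunction.evalCLM ℝ z).continuous.tendsto _).comp (hν f)
  -- The limit is the same from every initial state, so it can be averaged over stationary starts,
  -- where the value is p m at all times.
  have hsrc : ν (srcObs n (Pi.single m 1)) = p m := by
    have h1 : Tendsto (fun t => ∑ i, p i * semigroup (generator n Q lam ls) t
        (srcObs n (Pi.single m 1)) (State.fresh n i)) atTop
        (𝓝 (∑ i, p i * ν (srcObs n (Pi.single m 1)))) :=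
      tendsto_finsetSum _ fun i _ => (hpt _ _).const_mul _
    simp only [stationary_semigroup_srcObs hQ hp] at h1
    have h2 := tendsto_nhds_unique h1 tendsto_const_nhds
    rw [← Finset.sum_mul, hp.1.2, one_mul] at h2
    rw [h2]
    simp [Pi.single_apply]
  -- Applying ν to the drift inequality makes the left side 0.
  have hstale : ∀ j, ν (staleObs M j) ≤ (∑ i, ∑ r, |Q i r|) * n / ls := fun j => by
    have h1 := hmono _ (BoundedContinuousFunction.const _ (∑ i, ∑ r, |Q i r|)
      - (ls / n) • staleObs M j) (generator_staleObs_le hQ hn hlam hls.le j)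
    rw [hinv, map_sub, map_smul, hconst, smul_eq_mul] at h1
    rw [le_div_iff₀ hls]
    have h2 := mul_le_mul_of_nonneg_right (sub_nonneg.1 h1) hn0.le
    rwa [mul_right_comm, div_mul_cancel₀ _ hn0.ne', mul_comm] at h2
  have hperm : ∀ (σ : Equiv.Perm (Fin n)) f, ν (compReset (State.permute σ) f) = ν f :=
    fun σ f => by
      refine tendsto_nhds_unique (hpt _ (State.fresh n m)) ?_
      simp only [semigroup_compReset_permute]
      exact hpt _ _
  obtain ⟨A, hAk⟩ : ∃ A : Finset (Fin n), A.card = k :=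
    (Finset.exists_subset_card_eq (s := (Finset.univ : Finset (Fin n)))
      (by simpa using hkn)).imp fun _ h => h.2
  have hA : A.Nonempty := Finset.card_pos.1 (by omega)
  refine ⟨ν (freshObs A hA m), ν (accuracyObs A m), fun B hB hBk μ _ => ?_,
    fun B hBk μ _ => ?_, ?_, ?_⟩
  · obtain ⟨σ, hσ⟩ := exists_perm_map_eq (hAk.trans hBk.symm)
    rw [← hperm σ, compReset_permute_freshObs σ hA hB hσ]
    exact tendsto_expectation (hν _) μ
  · obtain ⟨σ, hσ⟩ := exists_perm_map_eq (hAk.trans hBk.symm)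
    rw [← hperm σ, compReset_permute_accuracyObs, hσ]
    exact tendsto_expectation (hν _) μ
  · obtain ⟨j, hj⟩ := hA
    have h1 := hmono _ _ (freshObs_le_srcObs A ⟨j, hj⟩ m)
    have h2 := hmono _ _ (srcObs_le_freshObs_add ⟨j, hj⟩ hj m)
    rw [map_add] at h2
    rw [abs_le]
    constructor <;> linarith [hstale j]
  · have h1 := hmono _ _ (accuracyObs_le_srcObs A m)
    have h2 := hmono _ _ (srcObs_le_accuracyObs_add hA m)
    have hc : (0 : ℝ) < A.card := by exact_mod_cast hA.card_pos
    have h3 : (A.card : ℝ)⁻¹ * ∑ l ∈ A, ν (staleObs M l) ≤ (∑ i, ∑ r, |Q i r|) * n / ls := by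
      rw [inv_mul_le_iff₀ hc, ← nsmul_eq_mul]
      exact Finset.sum_le_card_nsmul _ _ _ fun l _ => hstale l
    rw [map_add, map_smul, map_sum, smul_eq_mul] at h2
    rw [abs_le]
    constructor <;> linarith

theorem tendsto_of_abs_sub_le_div {f : ℝ → ℝ} {a C : ℝ} (h : ∀ x, 0 < x → |f x - a| ≤ C / x) :
    Tendsto f atTop (𝓝 a) := by
  refine tendsto_iff_dist_tendsto_zero.2 ?_
  exact squeeze_zero' (Eventually.of_forall fun _ => dist_nonneg)
    ((eventually_gt_atTop 0).mono fun x hx => h x hx) (tendsto_const_nhds.div_atTop tendsto_id)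

end Gossip

theorem mainTheorem9 {n M : ℕ} (Q : Matrix (Fin M) (Fin M) ℝ) (hQ : Gossip.IsGenerator Q)
    (hirr : Gossip.IsIrreducibleGenerator Q) (p : Fin M → ℝ) (hp : Gossip.IsStationary Q p)
    (lam : ℝ) (hlam : 0 ≤ lam) :
    ∃ g c : ℝ → ℕ → Fin M → ℝ,
      (∀ ls : ℝ, 0 < ls → ∀ k : ℕ, 1 ≤ k → k ≤ n → ∀ m : Fin M,
        Gossip.IsFreshnessLimit n Q lam ls k m (g ls k m) ∧
        Gossip.IsAccuracyLimit n Q lam ls k m (c ls k m)) ∧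
      ∀ k : ℕ, 1 ≤ k → k ≤ n →
        (∀ m : Fin M, Tendsto (fun ls => g ls k m) atTop (𝓝 (p m))) ∧
        Tendsto (fun ls => ∑ m, c ls k m * p m) atTop (𝓝 (∑ m, p m ^ 2)) ∧
        Tendsto (fun ls => ∑ m, c ls k m * g ls k m) atTop (𝓝 (∑ m, p m ^ 2)) := by
  have key : ∀ (ls : ℝ) (k : ℕ) (m : Fin M), ∃ g c : ℝ, 0 < ls → 1 ≤ k → k ≤ n →
      Gossip.IsFreshnessLimit n Q lam ls k m g ∧ Gossip.IsAccuracyLimit n Q lam ls k m c ∧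
      |g - p m| ≤ (∑ i, ∑ r, |Q i r|) * n / ls ∧
      |c - p m| ≤ (∑ i, ∑ r, |Q i r|) * n / ls := by
    intro ls k m
    by_cases h : 0 < ls ∧ 1 ≤ k ∧ k ≤ n
    · obtain ⟨g, c, hgc⟩ := Gossip.exists_limits hQ hirr hp hlam h.1 h.2.1 h.2.2 m
      exact ⟨g, c, fun _ _ _ => hgc⟩
    -- Arbitrary values outside the admissible range, so that g and c are total functions.
    · exact ⟨0, 0, fun h1 h2 h3 => absurd ⟨h1, h2, h3⟩ h⟩
  choose g c hgc using key
  refine ⟨g, c, fun ls hls k hk hkn m => ⟨(hgc ls k m hls hk hkn).1, (hgc ls k m hls hk hkn).2.1⟩,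
    fun k hk hkn => ?_⟩
  have hg : ∀ m, Tendsto (fun ls => g ls k m) atTop (𝓝 (p m)) := fun m =>
    Gossip.tendsto_of_abs_sub_le_div fun ls hls => (hgc ls k m hls hk hkn).2.2.1
  have hc : ∀ m, Tendsto (fun ls => c ls k m) atTop (𝓝 (p m)) := fun m =>
    Gossip.tendsto_of_abs_sub_le_div fun ls hls => (hgc ls k m hls hk hkn).2.2.2
  simp only [sq]
  exact ⟨hg, tendsto_finsetSum _ fun m _ => (hc m).mul_const _,
    tendsto_finsetSum _ fun m _ => (hc m).mul (hg m)⟩
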